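/- Let $L^2=L^2(\mathbb{R})$ (real-valued, inner product $(\cdot,\cdot)$, norm $\|\cdot\|$) and $H^1=H^1(\mathbb{R})$ with $\|v\|_{H^1}^2=\|v\|^2+\|\partial_x v\|^2$. Let $T>0$, and for $s\in[0,T]$ let $a(\cdot,\cdot;s)$ be a symmetric bilinear form on $H^1$, measurable in $s$, such that for constants $0<c_0<C_0$ and all $s\in[0,T]$, $v,w\in H^1$, $$|a(v,w;s)|\le C_0\|v\|_{H^1}\|w\|_{H^1},\qquad c_0\|v\|_{H^1}^2\le a(v,v;s).$$ For $0<t\le T$ let $X(0,t)$ be the space of $u\in L^2(0,t;H^1)$ with weak derivative $\partial_s u\in L^2(0,t;H^1)$ (represented by continuous functions $[0,t]\to H^1$), with $$\|u\|_{X(0,t)}^2=\int_0^t\big(\|u(\cdot,s)\|_{H^1}^2+\|\partial_su(\cdot,s)\|_{H^1}^2\big)\,ds+\|u(\cdot,0)\|^2 .$$ For $N\in\mathbb{N}$, $\beta>0$, $x_0\in\mathbb{R}$ let $P=P_{N,x_0}^\beta$ be the span of the functions $x\mapsto\hat{\mathcal H}_i(\beta(x-x_0))$, $0\le i\le N$,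 where $\hat{\mathcal H}_i(x)=(2^i i!)^{-1/2}H_i(x)e^{-x^2/2}$ and $H_i(x)=(-1)^ie^{x^2}\partial_x^ie^{-x^2}$. For $u\in X(0,t)$, $v\in L^2(0,t;P)$, $\tilde v\in P$ put $$B(u,(v,\tilde v))=\int_0^t\big[(\partial_su,v)+a(u,v;s)\big]ds+(u(\cdot,0),\tilde v),\qquad \|(v,\tilde v)\|_Y^2=\int_0^t\|v\|_{H^1}^2ds+\|\tilde v\|^2 .$$ (i) There is a constant $B_0\ge0$, depending only on $a$ (not on $t,N,\beta,x_0$), such that $B(u,(v,\tilde v))\le B_0\|u\|_{X(0,t)}\|(v,\tilde v)\|_Y$ for all $t\in(0,T]$, all $N,\beta,x_0$, all $u\in X(0,t)$ and all $(v,\tilde v)\in L^2(0,t;P)\times P$. (ii) Let $t\in(0,T]$, $N\in\mathbb{N}$, $\beta>0$, $x_0\in\mathbb{R}$, and let $B_0\ge0$ be any constant for which the inequality in (i) holds for these $t,N,\beta,x_0$. Let $u_0\in L^2$ and $f(\cdot,s)\in L^2$ for each $s$. Suppose $u\in X(0,t)$ is the weak solution of the parabolic model problem, i.e. for every $v\in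 H^1$, $$(\partial_su(\cdot,s),v)+a(u(\cdot,s),v;s)=(f(\cdot,s),v)\ \text{ for a.e. } s\in(0,t),\qquad (u(\cdot,0),v)=(u_0,v),$$ and $U\in X(0,t)\cap L^2(0,t;P)$ is its Galerkin solution, i.e. $$B(U,(v,\tilde v))=\int_0^t(f,v)\,ds+(u_0,\tilde v)\qquad\text{for all }(v,\tilde v)\in L^2(0,t;P)\times P .$$ Then $$\|u(\cdot,t)-U(\cdot,t)\|\le\frac{b_{N,\beta}+B_0}{b_{N,\beta}}\ \inf_{z}\|u-z\|_{X(0,t)},\qquad b_{N,\beta}=\min\Big\{\tfrac14,\ \tfrac{c_0}{4},\ \tfrac{c_0}{2(2N\beta^2+1)^2(C_0+1)^2}\Big\},$$ where the infimum is over all $z\in L^2(0,t;P)$ that belong to $X(0,t)$. -/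

import Mathlib

open MeasureTheory Set
open scoped ENNReal ContDiff

namespace HermiteGalerkin

/-- The real space `L²(ℝ)`, with its usual inner product and norm. -/
abbrev L2 : Type := Lp ℝ 2 (volume : Measure ℝ)

/-- `g` is the weak derivative of `f` on `ℝ`: integration by parts against all smooth compactly
supported test functions. -/
def IsWeakDeriv (f g : ℝ → ℝ) : Prop :=
  ∀ φ : ℝ → ℝ, ContDiff ℝ ∞ φ → HasCompactSupport φ →
    ∫ x, f x * deriv φ x = -∫ x, g x * φ x

theorem integral_add_mul (f g : L2) {ψ : ℝ → ℝ} (hψ : Continuous ψ) (hc : HasCompactSupport ψ) :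
    ∫ x, (f + g) x * ψ x = (∫ x, f x * ψ x) + ∫ x, g x * ψ x := by
  have hm : MemLp ψ 2 volume := hψ.memLp_of_hasCompactSupport hc
  have hf : Integrable (fun x => f x * ψ x) := (Lp.memLp f).integrable_mul hm
  have hg : Integrable (fun x => g x * ψ x) := (Lp.memLp g).integrable_mul hm
  rw [← integral_add hf hg]
  refine integral_congr_ae ?_
  filter_upwards [Lp.coeFn_add f g] with x hx
  rw [hx, Pi.add_apply, add_mul]

theorem integral_smul_mul (c : ℝ) (f : L2) (ψ : ℝ → ℝ) :
    ∫ x, (c • f) x * ψ x = c * ∫ x, f x * ψ x := by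
  rw [← integral_const_mul]
  refine integral_congr_ae ?_
  filter_upwards [Lp.coeFn_smul c f] with x hx
  simp [hx, mul_assoc]

theorem integral_zero_mul (ψ : ℝ → ℝ) : ∫ x, (0 : L2) x * ψ x = 0 := by
  rw [← integral_zero ℝ ℝ]
  refine integral_congr_ae ?_
  filter_upwards [Lp.coeFn_zero ℝ 2 (volume : Measure ℝ)] with x hx
  simp only [hx, Pi.zero_apply, zero_mul]

theorem continuous_integral_mul {ψ : ℝ → ℝ} (hψ : Continuous ψ) (hc : HasCompactSupport ψ) :
    Continuous fun f : L2 => ∫ x, f x * ψ x := by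
  have hm : MemLp ψ 2 volume := hψ.memLp_of_hasCompactSupport hc
  have key : (fun f : L2 => ∫ x, f x * ψ x) = fun f : L2 => inner ℝ (hm.toLp ψ) f := by
    funext f
    rw [L2.inner_def]
    refine integral_congr_ae ?_
    filter_upwards [hm.coeFn_toLp] with x hx
    simp [hx]
  rw [key]
  fun_prop

/-- The Sobolev space `H¹(ℝ)`: pairs `(v, v')` in `L²(ℝ) × L²(ℝ)` such that `v'` is the weak
derivative of `v`. It carries the inner product and norm of the Hilbert product, i.e.
`‖v‖² = ‖v‖²_{L²} + ‖v'‖²_{L²}`. -/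
def H1 : Submodule ℝ (WithLp 2 (L2 × L2)) where
  carrier := {p | IsWeakDeriv p.fst p.snd}
  zero_mem' := by
    intro φ _ _
    simp only [WithLp.zero_fst, WithLp.zero_snd, integral_zero_mul, neg_zero]
  add_mem' := by
    intro p q hp hq φ hφ hc
    have hd : Continuous (deriv φ) := hφ.continuous_deriv (by simp)
    have h1 := hp φ hφ hc
    have h2 := hq φ hφ hc
    simp only [WithLp.add_fst, WithLp.add_snd]
    rw [integral_add_mul _ _ hd hc.deriv, integral_add_mul _ _ hφ.continuous hc, h1, h2]
    ring
  smul_mem' := by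
    intro c p hp φ hφ hc
    have h1 := hp φ hφ hc
    simp only [WithLp.smul_fst, WithLp.smul_snd]
    rw [integral_smul_mul, integral_smul_mul, h1]
    ring

theorem isClosed_H1 : IsClosed (H1 : Set (WithLp 2 (L2 × L2))) := by
  have h : (H1 : Set (WithLp 2 (L2 × L2))) =
      ⋂ (φ : ℝ → ℝ) (_ : ContDiff ℝ ∞ φ) (_ : HasCompactSupport φ),
        {p | ∫ x, p.fst x * deriv φ x = -∫ x, p.snd x * φ x} := by
    ext p
    simp only [mem_iInter]
    rfl
  rw [h]
  refine isClosed_iInter fun φ => isClosed_iInter fun hφ => isClosed_iInter fun hc => ?_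
  have hd : Continuous (deriv φ) := hφ.continuous_deriv (by simp)
  exact isClosed_eq
    ((continuous_integral_mul hd hc.deriv).comp (WithLp.continuous_fst 2 L2 L2))
    ((continuous_integral_mul hφ.continuous hc).comp (WithLp.continuous_snd 2 L2 L2)).neg

instance : CompleteSpace H1 := isClosed_H1.completeSpace_coe

noncomputable section

/-- The embedding `H¹(ℝ) → L²(ℝ)`, linear. -/
def toL2 : H1 →ₗ[ℝ] L2 := (WithLp.fstₗ 2 ℝ L2 L2).comp H1.subtype

/-- The (physicists') Hermite polynomial `H_i(x) = (-1)^i e^{x²} ∂_x^i e^{-x²}`. -/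
def hermiteH (i : ℕ) (x : ℝ) : ℝ :=
  (-1) ^ i * Real.exp (x ^ 2) * iteratedDeriv i (fun y : ℝ => Real.exp (-y ^ 2)) x

/-- The Hermite function `(2^i i!)^{-1/2} H_i(x) e^{-x²/2}`. -/
def hermiteFun (i : ℕ) (x : ℝ) : ℝ :=
  1 / Real.sqrt (2 ^ i * (i.factorial : ℝ)) * hermiteH i x * Real.exp (-x ^ 2 / 2)

/-- The span `P_{N,x₀}^β` of the generalized Hermite functions `x ↦ Ĥ_i(β (x - x₀))`,
`i = 0, …, N`, as a subspace of `H¹(ℝ)`. -/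
def P (N : ℕ) (β x₀ : ℝ) : Submodule ℝ H1 where
  carrier := {v | ∃ c : Fin (N + 1) → ℝ,
    ∀ᵐ x, toL2 v x = ∑ i : Fin (N + 1), c i * hermiteFun i (β * (x - x₀))}
  zero_mem' := by
    refine ⟨0, ?_⟩
    rw [map_zero]
    filter_upwards [Lp.coeFn_zero ℝ 2 (volume : Measure ℝ)] with x hx
    rw [hx]
    simp
  add_mem' := by
    rintro v w ⟨c, hc⟩ ⟨d, hd⟩
    refine ⟨c + d, ?_⟩
    rw [map_add]
    filter_upwards [Lp.coeFn_add (toL2 v) (toL2 w), hc, hd] with x hx h1 h2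
    rw [hx, Pi.add_apply, h1, h2]
    simp [add_mul, Finset.sum_add_distrib]
  smul_mem' := by
    rintro r v ⟨c, hc⟩
    refine ⟨r • c, ?_⟩
    rw [map_smul]
    filter_upwards [Lp.coeFn_smul r (toL2 v), hc] with x hx h1
    rw [hx, Pi.smul_apply, h1]
    simp [Finset.mul_sum, mul_assoc]

/-- `v ∈ L²(0, t; V)` for a subspace `V` of `H¹(ℝ)`. -/
def MemL2Time (t : ℝ) (V : Submodule ℝ H1) (v : ℝ → H1) : Prop :=
  MemLp v 2 (volume.restrict (Ioc 0 t)) ∧ ∀ᵐ s ∂(volume.restrict (Ioc 0 t)), v s ∈ V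

/-- `u ∈ X(0, t)` with time derivative `du`: both `u` and its weak time derivative `du` belong to
`L²(0, t; H¹(ℝ))`. As `u(·, 0)` and `u(·, t)` are used, `u` is the continuous representative of
its class. -/
structure MemX (t : ℝ) (u du : ℝ → H1) : Prop where
  continuousOn : ContinuousOn u (Icc 0 t)
  memLp : MemLp u 2 (volume.restrict (Ioc 0 t))
  memLp_deriv : MemLp du 2 (volume.restrict (Ioc 0 t))
  weak_deriv : ∀ φ : ℝ → ℝ, ContDiff ℝ ∞ φ → HasCompactSupport φ → tsupport φ ⊆ Ioo 0 t →
    ∫ s in (0 : ℝ)..t, deriv φ s • u s = -∫ s in (0 : ℝ)..t, φ s • du s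

/-- The norm of `X(0, t)`, for `u` with time derivative `du`. -/
def normX (t : ℝ) (u du : ℝ → H1) : ℝ :=
  Real.sqrt ((∫ s in (0 : ℝ)..t, (‖u s‖ ^ 2 + ‖du s‖ ^ 2)) + ‖toL2 (u 0)‖ ^ 2)

/-- The norm of `Y = L²(0, t; P) × P`. -/
def normY (t : ℝ) (v : ℝ → H1) (w : H1) : ℝ :=
  Real.sqrt ((∫ s in (0 : ℝ)..t, ‖v s‖ ^ 2) + ‖toL2 w‖ ^ 2)

/-- `inf ‖u - z‖_{X(0,t)}` over the `V`-valued functions `z ∈ L²(0, t; V)` that lie in `X(0, t)`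
(those for which the norm makes sense). Here `z.1` is the function and `z.2` its time
derivative. -/
def bestApprox (t : ℝ) (V : Submodule ℝ H1) (u du : ℝ → H1) : ℝ :=
  ⨅ z : {z : (ℝ → H1) × (ℝ → H1) // MemL2Time t V z.1 ∧ MemX t z.1 z.2},
    normX t (u - z.1.1) (du - z.1.2)

/-- `a(·, ·; s)`, `s ∈ [0, T]`, is a family of symmetric bilinear forms on `H¹(ℝ)`, measurable in
time, bounded with constant `C₀` and coercive with constant `c₀`, uniformly in time. -/
structure IsModelForm (T c₀ C₀ : ℝ) (a : ℝ → LinearMap.BilinForm ℝ H1) : Prop where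
  pos : 0 < c₀
  lt : c₀ < C₀
  measurable : ∀ v w : H1,
    AEStronglyMeasurable (fun s => a s v w) (volume.restrict (Icc 0 T))
  symm : ∀ s ∈ Icc 0 T, ∀ v w : H1, a s v w = a s w v
  bounded : ∀ s ∈ Icc 0 T, ∀ v w : H1, |a s v w| ≤ C₀ * ‖v‖ * ‖w‖
  coercive : ∀ s ∈ Icc 0 T, ∀ v : H1, c₀ * ‖v‖ ^ 2 ≤ a s v v

/-- The space-time form
`B(u, (v, w)) = ∫₀ᵗ [(∂ₛu, v) + a(u, v; s)] ds + (u(·, 0), w)`. -/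
def spaceTimeForm (a : ℝ → LinearMap.BilinForm ℝ H1) (t : ℝ) (u du v : ℝ → H1) (w : H1) : ℝ :=
  (∫ s in (0 : ℝ)..t, (inner ℝ (toL2 (du s)) (toL2 (v s)) + a s (u s) (v s)))
    + inner ℝ (toL2 (u 0)) (toL2 w)

/-- `B₀ ≥ 0` is a continuity constant of the space-time form on `X(0, t) × Y`, where
`Y = L²(0, t; V) × V`. -/
def IsContinuityConst (a : ℝ → LinearMap.BilinForm ℝ H1) (t : ℝ) (V : Submodule ℝ H1)
    (B₀ : ℝ) : Prop :=
  0 ≤ B₀ ∧ ∀ u du v : ℝ → H1, ∀ w : H1, MemX t u du → MemL2Time t V v → w ∈ V →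
    spaceTimeForm a t u du v w ≤ B₀ * normX t u du * normY t v w

/-- `u ∈ X(0, t)`, with time derivative `du`, is the weak solution on `[0, t]` of the parabolic
model problem with source `f` and initial value `u₀`. -/
structure IsWeakSolution (a : ℝ → LinearMap.BilinForm ℝ H1) (f : ℝ → L2) (u₀ : L2) (t : ℝ)
    (u du : ℝ → H1) : Prop where
  memX : MemX t u du
  equation : ∀ v : H1, ∀ᵐ s ∂(volume.restrict (Ioc 0 t)),
    inner ℝ (toL2 (du s)) (toL2 v) + a s (u s) v = inner ℝ (f s) (toL2 v)
  initial : ∀ v : H1, inner ℝ (toL2 (u 0)) (toL2 v) = inner ℝ u₀ (toL2 v)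

/-- `U ∈ L²(0, t; V)`, with time derivative `dU`, is the Galerkin solution on `[0, t]` with trial
and test space `V`. -/
structure IsGalerkinSolution (a : ℝ → LinearMap.BilinForm ℝ H1) (f : ℝ → L2) (u₀ : L2) (t : ℝ)
    (V : Submodule ℝ H1) (U dU : ℝ → H1) : Prop where
  memX : MemX t U dU
  memL2 : MemL2Time t V U
  equation : ∀ v : ℝ → H1, ∀ w : H1, MemL2Time t V v → w ∈ V →
    spaceTimeForm a t U dU v w =
      (∫ s in (0 : ℝ)..t, inner ℝ (f s) (toL2 (v s))) + inner ℝ u₀ (toL2 w)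

/-- The constant `b_{N,β} = min {1/4, c₀/4, c₀ / (2 (2Nβ² + 1)² (C₀ + 1)²)}`. -/
def bConst (c₀ C₀ : ℝ) (N : ℕ) (β : ℝ) : ℝ :=
  min (1 / 4) (min (c₀ / 4) (c₀ / (2 * (2 * N * β ^ 2 + 1) ^ 2 * (C₀ + 1) ^ 2)))

end

end HermiteGalerkin

/-!
The error bound is a quasi-optimality argument. For a competitor `z`, put `e = U - z`. Testing the
space-time form with `(e, e(0))` and using the energy identity
`2 ∫ (∂ₛe, e) = ‖e(t)‖² - ‖e(0)‖²` and coercivity gives (`le_spaceTimeForm_self`)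

  `½ ‖e(t)‖² + min(½, c₀) ‖(e, e(0))‖_Y² ≤ B(e, (e, e(0)))`.

The weak and the Galerkin solution satisfy the same space-time equation for `P`-valued test
functions, so the right-hand side equals `B(u - z, (e, e(0)))`, which is at most
`B₀ ‖u - z‖_X ‖(e, e(0))‖_Y`. As `b_{N,β}² ≤ 2 min(½, c₀)`, Young's inequality yields
`b_{N,β} ‖e(t)‖ ≤ B₀ ‖u - z‖_X` (`norm_toL2_sub_le_of_galerkin`). The trace estimate
`‖(u - z)(t)‖ ≤ ‖u - z‖_X` (`MemX.norm_toL2_apply_le`) and the triangle inequality finish the proof.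
No inverse inequality for the Hermite functions is needed, because only the final value of `e`, and
not its time derivative, has to be controlled.

The analytic substance is in four facts:
* a continuous curve with integrable weak derivative is the primitive of that derivative
  (`eq_add_integral_of_weak_deriv`, from the du Bois-Reymond lemma), whence the energy identity
  `integral_inner_eq_of_primitive`;
* `s ↦ a(u(s), v(s); s)` is measurable (`IsModelForm.aestronglyMeasurable_apply`), which makes the
  space-time form additive;
* `H¹(ℝ)` is separable, so that the weak formulation may be tested with time-dependent functions
  (`IsWeakSolution.spaceTimeForm_eq`);
* `P` is closed in `H¹(ℝ)` (`isClosed_P`), so that `e(0) ∈ P` is an admissible test vector.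

The continuity constant `1 + C₀` comes from the Cauchy–Schwarz inequality.
-/

namespace HermiteGalerkin

/-! ### Absolutely continuous curves in a Banach space -/

section Analysis

variable {E : Type*} [NormedAddCommGroup E] [NormedSpace ℝ E]

theorem absolutelyContinuousOnInterval_of_dist_le {X Y : Type*} [PseudoMetricSpace X]
    [PseudoMetricSpace Y] {f : ℝ → X} {g : ℝ → Y} {a b : ℝ}
    (hg : AbsolutelyContinuousOnInterval g a b)
    (hfg : ∀ x ∈ uIcc a b, ∀ y ∈ uIcc a b, dist (f x) (f y) ≤ dist (g x) (g y)) :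
    AbsolutelyContinuousOnInterval f a b := by
  rw [absolutelyContinuousOnInterval_iff] at hg ⊢
  intro ε hε
  obtain ⟨δ, hδ, h⟩ := hg ε hε
  refine ⟨δ, hδ, fun I hI hlen => lt_of_le_of_lt (Finset.sum_le_sum fun i hi => ?_) (h I hI hlen)⟩
  exact hfg _ (hI.1 i hi).1 _ (hI.1 i hi).2

theorem dist_integral_le_dist_integral_norm {f : ℝ → E} {a b x y : ℝ}
    (hf : IntervalIntegrable f volume a b) (hx : x ∈ uIcc a b) (hy : y ∈ uIcc a b) :
    dist (∫ s in a..x, f s) (∫ s in a..y, f s) ≤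
      dist (∫ s in a..x, ‖f s‖) (∫ s in a..y, ‖f s‖) := by
  have hax : IntervalIntegrable f volume a x :=
    hf.mono_set (uIcc_subset_uIcc left_mem_uIcc hx)
  have hay : IntervalIntegrable f volume a y :=
    hf.mono_set (uIcc_subset_uIcc left_mem_uIcc hy)
  rw [dist_eq_norm, dist_eq_norm, intervalIntegral.integral_interval_sub_left hax hay,
    intervalIntegral.integral_interval_sub_left hax.norm hay.norm, Real.norm_eq_abs]
  exact intervalIntegral.norm_integral_le_abs_integral_norm

theorem absolutelyContinuousOnInterval_integral {f : ℝ → E} {a b : ℝ}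
    (hf : IntervalIntegrable f volume a b) :
    AbsolutelyContinuousOnInterval (fun x => ∫ s in a..x, f s) a b :=
  absolutelyContinuousOnInterval_of_dist_le
    (hf.norm.absolutelyContinuousOnInterval_intervalIntegral left_mem_uIcc)
    fun _ hx _ hy => dist_integral_le_dist_integral_norm hf hx hy

/-- The fundamental theorem of calculus for absolutely continuous curves in a Banach space that
are differentiable almost everywhere. -/
theorem integral_eq_sub_of_absolutelyContinuous [CompleteSpace E] {f f' : ℝ → E} {a b : ℝ}
    (hf : AbsolutelyContinuousOnInterval f a b) (hf' : IntervalIntegrable f' volume a b)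
    (hd : ∀ᵐ x, x ∈ uIcc a b → HasDerivAt f (f' x) x) :
    ∫ s in a..b, f' s = f b - f a := by
  obtain ⟨C, hC⟩ :=
    (hf.sub (absolutelyContinuousOnInterval_integral hf')).const_of_ae_hasDerivAt_zero (by
      filter_upwards [hd, hf'.ae_hasDerivAt_integral] with x hx hx' hxab
      simpa using (hx hxab).sub (hx' hxab a left_mem_uIcc))
  have ha := hC a left_mem_uIcc
  have hb := hC b right_mem_uIcc
  simp only [Pi.sub_apply, intervalIntegral.integral_same, sub_zero] at ha hb
  rw [ha, ← hb]
  abel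

theorem integral_smul_integral_eq_neg [CompleteSpace E] {f : ℝ → E} {t : ℝ} {φ : ℝ → ℝ}
    (hf : IntervalIntegrable f volume 0 t) (hφ : ContDiff ℝ ∞ φ) (h0 : φ 0 = 0) (ht : φ t = 0) :
    ∫ s in (0 : ℝ)..t, deriv φ s • ∫ r in (0 : ℝ)..s, f r = -∫ s in (0 : ℝ)..t, φ s • f s := by
  have hac := absolutelyContinuousOnInterval_integral hf
  have hcd : Continuous (deriv φ) := hφ.continuous_deriv (by simp)
  have hi1 : IntervalIntegrable (fun s => deriv φ s • ∫ r in (0 : ℝ)..s, f r) volume 0 t :=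
    (hcd.continuousOn.smul hac.continuousOn).intervalIntegrable
  have hi2 : IntervalIntegrable (fun s => φ s • f s) volume 0 t :=
    hf.continuousOn_smul hφ.continuous.continuousOn
  have hφac : AbsolutelyContinuousOnInterval φ 0 t :=
    (hφ.of_le (by exact_mod_cast le_top)).contDiffOn.absolutelyContinuousOnInterval
  have key := integral_eq_sub_of_absolutelyContinuous (hφac.smul hac) (hi2.add hi1) (by
    filter_upwards [hf.ae_hasDerivAt_integral] with x hx hxt
    have hφx : HasDerivAt φ (deriv φ x) x := (hφ.differentiable (by simp) x).hasDerivAt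
    exact hφx.smul (hx hxt 0 left_mem_uIcc))
  simp only [Pi.smul_apply', h0, ht, zero_smul, sub_zero] at key
  rw [intervalIntegral.integral_add hi2 hi1] at key
  rw [eq_neg_iff_add_eq_zero, add_comm]
  exact key

/-! ### Weak derivatives on a bounded interval -/

theorem Icc_of_isCompact_subset_Ioo {K : Set ℝ} {t : ℝ} (ht : 0 < t) (hK : IsCompact K)
    (hKt : K ⊆ Ioo 0 t) : ∃ α β, 0 < α ∧ α ≤ β ∧ β < t ∧ K ⊆ Icc α β := by
  rcases K.eq_empty_or_nonempty with rfl | hne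
  · exact ⟨t / 2, t / 2, by linarith, le_rfl, by linarith, empty_subset _⟩
  · obtain ⟨α, hα⟩ := hK.exists_isLeast hne
    obtain ⟨β, hβ⟩ := hK.exists_isGreatest hne
    exact ⟨α, β, (hKt hα.1).1, hα.2 hβ.1, (hKt hβ.1).2, fun x hx => ⟨hα.2 hx, hβ.2 hx⟩⟩

/-- A test function with zero mean is the derivative of a test function. -/
theorem exists_primitive_of_integral_eq_zero {t : ℝ} (ht : 0 < t) {ψ : ℝ → ℝ}
    (hψ : ContDiff ℝ ∞ ψ) (hc : HasCompactSupport ψ) (hs : tsupport ψ ⊆ Ioo 0 t)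
    (h0 : ∫ x, ψ x = 0) :
    ∃ φ : ℝ → ℝ, ContDiff ℝ ∞ φ ∧ HasCompactSupport φ ∧ tsupport φ ⊆ Ioo 0 t ∧ deriv φ = ψ := by
  obtain ⟨α, β, hα, hαβ, hβ, hsub⟩ := Icc_of_isCompact_subset_Ioo ht hc hs
  have hout : ∀ x, x ∉ Icc α β → ψ x = 0 := fun x hx =>
    image_eq_zero_of_notMem_tsupport fun h => hx (hsub h)
  have hderiv : ∀ x, HasDerivAt (fun y => ∫ r in α..y, ψ r) (ψ x) x := fun x =>
    intervalIntegral.integral_hasDerivAt_right (hψ.continuous.intervalIntegrable _ _)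
      (hψ.continuous.stronglyMeasurableAtFilter _ _) hψ.continuous.continuousAt
  have hd : deriv (fun y => ∫ r in α..y, ψ r) = ψ := funext fun x => (hderiv x).deriv
  have hzero : ∀ x, x ∉ Icc α β → ∫ r in α..x, ψ r = 0 := by
    intro x hx
    by_cases hxα : x < α
    · rw [intervalIntegral.integral_symm, neg_eq_zero]
      refine intervalIntegral.integral_zero_ae ?_
      filter_upwards [Measure.ae_ne volume α] with r hrα hr
      rw [uIoc_of_le hxα.le] at hr
      exact hout r fun h => hrα (le_antisymm hr.2 h.1)
    · have hxβ : β < x := by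
        by_contra! h
        exact hx ⟨not_lt.1 hxα, h⟩
      rw [intervalIntegral.integral_of_le (by linarith), ← h0, ← integral_Icc_eq_integral_Ioc]
      refine setIntegral_eq_integral_of_forall_compl_eq_zero fun r hr => hout r fun h => hr ?_
      exact ⟨h.1, h.2.trans hxβ.le⟩
  have hts : tsupport (fun y => ∫ r in α..y, ψ r) ⊆ Icc α β :=
    closure_minimal (fun x hx => by_contra fun h => hx (hzero x h)) isClosed_Icc
  refine ⟨fun y => ∫ r in α..y, ψ r, ?_, isCompact_Icc.of_isClosed_subset (isClosed_tsupport _) hts,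
    hts.trans fun x hx => ⟨hα.trans_le hx.1, hx.2.trans_lt hβ⟩, hd⟩
  rw [contDiff_infty_iff_deriv, hd]
  exact ⟨fun x => (hderiv x).differentiableAt, hψ⟩

theorem intervalIntegral_eq_integral_of_tsupport_subset {t : ℝ} (ht : 0 ≤ t) {ψ : ℝ → ℝ}
    (hs : tsupport ψ ⊆ Ioo 0 t) (g : ℝ → E) :
    ∫ s in (0 : ℝ)..t, ψ s • g s = ∫ s, ψ s • g s := by
  rw [intervalIntegral.integral_of_le ht]
  refine setIntegral_eq_integral_of_forall_compl_eq_zero fun x hx => ?_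
  rw [image_eq_zero_of_notMem_tsupport fun h => hx (Ioo_subset_Ioc_self (hs h)), zero_smul]

theorem integrable_smul_of_tsupport_subset {t : ℝ} {ψ : ℝ → ℝ} (hψ : Continuous ψ)
    (hs : tsupport ψ ⊆ Ioo 0 t) {g : ℝ → E} (hg : ContinuousOn g (Icc 0 t)) :
    Integrable fun s => ψ s • g s := by
  have h : IntegrableOn (fun s => ψ s • g s) (Icc 0 t) :=
    (hψ.continuousOn.smul hg).integrableOn_compact isCompact_Icc
  refine (integrableOn_iff_integrable_of_support_subset fun x hx => ?_).1 h
  have hx' : ψ x ≠ 0 := fun h => hx (by simp [h])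
  exact Ioo_subset_Icc_self (hs (subset_tsupport _ hx'))

/-- The du Bois-Reymond lemma for continuous curves: a vanishing weak derivative forces the curve
to be constant, up to the end points. -/
theorem eqOn_const_of_weak_deriv_eq_zero [CompleteSpace E] {t : ℝ} (ht : 0 < t) {g : ℝ → E}
    (hg : ContinuousOn g (Icc 0 t))
    (hw : ∀ φ : ℝ → ℝ, ContDiff ℝ ∞ φ → HasCompactSupport φ → tsupport φ ⊆ Ioo 0 t →
      ∫ s in (0 : ℝ)..t, deriv φ s • g s = 0) :
    ∃ c, EqOn g (fun _ => c) (Icc 0 t) := by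
  let bump : ContDiffBump (t / 2) := ⟨t / 8, t / 4, by positivity, by linarith⟩
  set ρ : ℝ → ℝ := bump.normed volume with hρ
  have hρs : ContDiff ℝ ∞ ρ := bump.contDiff_normed
  have hρc : HasCompactSupport ρ := bump.hasCompactSupport_normed
  have hρt : tsupport ρ ⊆ Ioo 0 t := by
    rw [hρ, bump.tsupport_normed_eq, Real.closedBall_eq_Icc]
    intro x hx
    have h1 : t / 2 - t / 4 ≤ x := hx.1
    have h2 : x ≤ t / 2 + t / 4 := hx.2
    constructor <;> linarith
  have hρ1 : ∫ x, ρ x = 1 := bump.integral_normed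
  set c : E := ∫ s, ρ s • g s
  refine ⟨c, ?_⟩
  have hae : ∀ᵐ s, s ∈ Ioo 0 t → g s - c = 0 := by
    refine isOpen_Ioo.ae_eq_zero_of_integral_contDiff_smul_eq_zero ?_ ?_
    · exact ((hg.mono Ioo_subset_Icc_self).sub continuousOn_const).locallyIntegrableOn
        measurableSet_Ioo
    · intro ψ hψ hψc hψt
      set m : ℝ := ∫ x, ψ x
      -- Subtracting the multiple `m` of the normalized bump makes the mean vanish.
      have hsm : ContDiff ℝ ∞ (fun x => ψ x - m * ρ x) := hψ.sub (contDiff_const.mul hρs)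
      have hst : tsupport (fun x => ψ x - m * ρ x) ⊆ tsupport ψ ∪ tsupport ρ := by
        refine closure_minimal (fun x hx => ?_)
          ((isClosed_tsupport _).union (isClosed_tsupport _))
        by_contra h
        rw [mem_union, not_or] at h
        exact hx (by simp [image_eq_zero_of_notMem_tsupport h.1,
          image_eq_zero_of_notMem_tsupport h.2])
      have hsc : HasCompactSupport (fun x => ψ x - m * ρ x) :=
        (hψc.isCompact.union hρc.isCompact).of_isClosed_subset (isClosed_tsupport _) hst
      have hs0 : ∫ x, (ψ x - m * ρ x) = 0 := by
        rw [integral_sub (hψ.continuous.integrable_of_hasCompactSupport hψc)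
          ((hρs.continuous.integrable_of_hasCompactSupport hρc).const_mul m),
          integral_const_mul, hρ1, mul_one, sub_self]
      obtain ⟨φ, hφ, hφc, hφt, hφd⟩ := exists_primitive_of_integral_eq_zero ht hsm hsc
        (hst.trans (union_subset hψt hρt)) hs0
      have h := hw φ hφ hφc hφt
      rw [hφd, intervalIntegral_eq_integral_of_tsupport_subset ht.le
        (hst.trans (union_subset hψt hρt))] at h
      have hi1 := integrable_smul_of_tsupport_subset hψ.continuous hψt hg
      have hi2 := integrable_smul_of_tsupport_subset hρs.continuous hρt hg
      simp only [sub_smul, mul_smul] at h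
      have hi3 : Integrable fun s => m • ρ s • g s := hi2.smul m
      rw [integral_sub hi1 hi3, integral_smul, sub_eq_zero] at h
      simp only [smul_sub]
      rw [integral_sub hi1
        ((hψ.continuous.integrable_of_hasCompactSupport hψc).smul_const c), h,
        integral_smul_const, sub_self]
  refine Measure.eqOn_Icc_of_ae_eq volume ht.ne ?_ hg continuousOn_const
  rw [← restrict_Ioo_eq_restrict_Icc]
  rw [Filter.EventuallyEq, ae_restrict_iff' measurableSet_Ioo]
  filter_upwards [hae] with s hs hst
  exact sub_eq_zero.1 (hs hst)

/-- A continuous curve with an integrable weak derivative is the primitive of that derivative. -/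
theorem eq_add_integral_of_weak_deriv [CompleteSpace E] {t : ℝ} (ht : 0 < t) {u du : ℝ → E}
    (hu : ContinuousOn u (Icc 0 t)) (hdu : IntervalIntegrable du volume 0 t)
    (hw : ∀ φ : ℝ → ℝ, ContDiff ℝ ∞ φ → HasCompactSupport φ → tsupport φ ⊆ Ioo 0 t →
      ∫ s in (0 : ℝ)..t, deriv φ s • u s = -∫ s in (0 : ℝ)..t, φ s • du s) :
    ∀ s ∈ Icc 0 t, u s = u 0 + ∫ r in (0 : ℝ)..s, du r := by
  have hac := (absolutelyContinuousOnInterval_integral hdu).continuousOn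
  rw [uIcc_of_le ht.le] at hac
  obtain ⟨c, hc⟩ := eqOn_const_of_weak_deriv_eq_zero ht (g := fun s => u s - ∫ r in (0 : ℝ)..s, du r)
    (hu.sub hac) (by
    intro φ hφ hφc hφt
    have hcd : Continuous (deriv φ) := hφ.continuous_deriv (by simp)
    have hi1 : IntervalIntegrable (fun s => deriv φ s • u s) volume 0 t := by
      refine ContinuousOn.intervalIntegrable ?_
      rw [uIcc_of_le ht.le]
      exact hcd.continuousOn.smul hu
    have hi2 : IntervalIntegrable (fun s => deriv φ s • ∫ r in (0 : ℝ)..s, du r) volume 0 t := by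
      refine ContinuousOn.intervalIntegrable ?_
      rw [uIcc_of_le ht.le]
      exact hcd.continuousOn.smul hac
    have h0 : φ 0 = 0 := image_eq_zero_of_notMem_tsupport fun h => lt_irrefl _ (hφt h).1
    have h1 : φ t = 0 := image_eq_zero_of_notMem_tsupport fun h => lt_irrefl _ (hφt h).2
    simp only [smul_sub]
    rw [intervalIntegral.integral_sub hi1 hi2, hw φ hφ hφc hφt,
      integral_smul_integral_eq_neg hdu hφ h0 h1, sub_self])
  intro s hs
  have h0 := hc (left_mem_Icc.2 ht.le)
  have h1 := hc hs
  simp only [intervalIntegral.integral_same, sub_zero] at h0 h1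
  rw [h0, ← h1]
  abel

/-- The energy identity: `‖w‖²` is absolutely continuous along a primitive `w` of an integrable
curve in a Hilbert space, with almost everywhere derivative `2 (w', w)`. -/
theorem integral_inner_eq_of_primitive {H : Type*} [NormedAddCommGroup H] [InnerProductSpace ℝ H]
    [CompleteSpace H] {t : ℝ} {w dw : ℝ → H} (ht : 0 ≤ t) (hdw : IntervalIntegrable dw volume 0 t)
    (hw : ∀ s ∈ Icc 0 t, w s = w 0 + ∫ r in (0 : ℝ)..s, dw r) :
    2 * ∫ s in (0 : ℝ)..t, inner ℝ (dw s) (w s) = ‖w t‖ ^ 2 - ‖w 0‖ ^ 2 := by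
  set W : ℝ → H := fun s => w 0 + ∫ r in (0 : ℝ)..s, dw r with hW
  have hWac : AbsolutelyContinuousOnInterval W 0 t :=
    absolutelyContinuousOnInterval_of_dist_le (absolutelyContinuousOnInterval_integral hdw)
      fun x _ y _ => by simp [hW]
  obtain ⟨M, hM⟩ := hWac.exists_bound
  have hM0 : 0 ≤ M := (norm_nonneg _).trans (hM 0 left_mem_uIcc)
  have hsq : AbsolutelyContinuousOnInterval (fun s => ‖W s‖ ^ 2) 0 t := by
    refine absolutelyContinuousOnInterval_of_dist_le (hWac.const_smul (2 * M)) fun x hx y hy => ?_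
    have hx' := hM x hx
    have hy' := hM y hy
    have h1 := abs_norm_sub_norm_le (W x) (W y)
    rw [Real.dist_eq, sq_sub_sq, abs_mul, abs_of_nonneg (by positivity)]
    change _ ≤ dist ((2 * M) • W x) ((2 * M) • W y)
    rw [dist_smul₀, dist_eq_norm, Real.norm_of_nonneg (by positivity)]
    exact mul_le_mul (by linarith) h1 (abs_nonneg _) (by positivity)
  have hcont := hWac.continuousOn
  have hint : IntervalIntegrable (fun s => inner ℝ (dw s) (W s)) volume 0 t := by
    refine (hdw.norm.mul_const M).mono_fun ?_ ?_
    · exact hdw.aestronglyMeasurable_restrict_uIoc.inner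
        ((hcont.mono uIoc_subset_uIcc).aestronglyMeasurable measurableSet_uIoc)
    · refine (ae_restrict_iff' measurableSet_uIoc).2 (Filter.Eventually.of_forall fun s hs => ?_)
      beta_reduce
      rw [Real.norm_of_nonneg (by positivity : 0 ≤ ‖dw s‖ * M)]
      exact (norm_inner_le_norm _ _).trans
        (mul_le_mul_of_nonneg_left (hM s (uIoc_subset_uIcc hs)) (norm_nonneg _))
  have key := integral_eq_sub_of_absolutelyContinuous hsq (hint.const_mul 2) (by
    filter_upwards [hdw.ae_hasDerivAt_integral] with x hx hxt
    have h := ((hx hxt 0 left_mem_uIcc).const_add (w 0)).norm_sq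
    rw [real_inner_comm]
    exact h)
  rw [intervalIntegral.integral_const_mul] at key
  have h0 : W 0 = w 0 := by simp [hW]
  have h1 : W t = w t := (hw t (right_mem_Icc.2 ht)).symm
  simp only [h0, h1] at key
  rw [← key]
  congr 1
  refine intervalIntegral.integral_congr fun s hs => ?_
  rw [uIcc_of_le ht] at hs
  simp only [hW, ← hw s hs]

/-! ### Measurability along curves and the Cauchy–Schwarz inequality -/

/-- Evaluating a Carathéodory function (measurable in time, continuous in space) along a measurable
curve gives a measurable function. -/
theorem aestronglyMeasurable_apply_curve {X : Type*} [NormedAddCommGroup X] {μ : Measure ℝ}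
    {g : ℝ → X → ℝ}
    (hg : ∀ x, AEStronglyMeasurable (fun s => g s x) μ) (hc : ∀ᵐ s ∂μ, Continuous (g s))
    {u : ℝ → X} (hu : AEStronglyMeasurable u μ) :
    AEStronglyMeasurable (fun s => g s (u s)) μ := by
  have hsimple : ∀ φ : SimpleFunc ℝ X, AEStronglyMeasurable (fun s => g s (φ s)) μ := by
    intro φ
    have hsum : (fun s => g s (φ s)) =
        fun s => ∑ y ∈ φ.range, (φ ⁻¹' {y}).indicator (fun r => g r y) s := by
      funext s
      rw [Finset.sum_eq_single (φ s)]
      · simp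
      · intro y _ hy
        exact indicator_of_notMem (fun h => hy (by simpa using h.symm)) _
      · intro h
        exact absurd (φ.mem_range_self s) h
    rw [hsum]
    exact Finset.aestronglyMeasurable_fun_sum _ fun y _ =>
      (hg y).indicator (φ.measurableSet_fiber y)
  have hmk : AEStronglyMeasurable (fun s => g s (hu.mk u s)) μ := by
    refine aestronglyMeasurable_of_tendsto_ae Filter.atTop
      (fun n => hsimple (hu.stronglyMeasurable_mk.approx n)) ?_
    filter_upwards [hc] with s hs
    exact (hs.tendsto _).comp (hu.stronglyMeasurable_mk.tendsto_approx s)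
  refine hmk.congr ?_
  filter_upwards [hu.ae_eq_mk] with s hs
  rw [hs]

theorem integral_mul_le_sqrt_mul_sqrt {α : Type*} [MeasurableSpace α] {μ : Measure α}
    {f g : α → ℝ} (hf0 : ∀ x, 0 ≤ f x) (hg0 : ∀ x, 0 ≤ g x) (hf : MemLp f 2 μ)
    (hg : MemLp g 2 μ) :
    ∫ x, f x * g x ∂μ ≤ √(∫ x, f x ^ 2 ∂μ) * √(∫ x, g x ^ 2 ∂μ) := by
  have h := integral_mul_le_Lp_mul_Lq_of_nonneg (μ := μ) Real.HolderConjugate.two_two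
    (Filter.Eventually.of_forall hf0) (Filter.Eventually.of_forall hg0)
    (by simpa using hf) (by simpa using hg)
  simpa [Real.sqrt_eq_rpow] using h

end Analysis

/-! ### The spaces `H¹(ℝ)` and `P` -/

noncomputable section

/-- The embedding `H¹(ℝ) → L²(ℝ)` as a continuous linear map. -/
def toL2L : H1 →L[ℝ] L2 := (WithLp.fstL 2 ℝ L2 L2).comp H1.subtypeL

theorem norm_toL2_le (v : H1) : ‖toL2 v‖ ≤ ‖v‖ := WithLp.norm_fst_le L2 (v : WithLp 2 (L2 × L2))

theorem abs_inner_toL2_le (v w : H1) : |inner ℝ (toL2 v) (toL2 w)| ≤ ‖v‖ * ‖w‖ :=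
  (abs_real_inner_le_norm _ _).trans
    (mul_le_mul (norm_toL2_le v) (norm_toL2_le w) (norm_nonneg _) (norm_nonneg _))

theorem separableSpace_H1 : TopologicalSpace.SeparableSpace H1 := by
  have : Fact ((2 : ℝ≥0∞) ≠ ⊤) := ⟨by simp⟩
  have : SecondCountableTopology L2 := inferInstance
  have : SecondCountableTopology (WithLp 2 (L2 × L2)) :=
    (WithLp.homeomorphProd 2 L2 L2).secondCountableTopology
  have : SecondCountableTopology H1 :=
    inferInstanceAs (SecondCountableTopology (H1 : Set (WithLp 2 (L2 × L2))))
  infer_instance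

/-- The coefficient vectors whose linear combination of the functions `h i` lies in `L²(ℝ)`.
Restricting to them avoids having to show that each `h i` is square integrable. -/
def memLpCoeffs {n : ℕ} (h : Fin n → ℝ → ℝ) : Submodule ℝ (Fin n → ℝ) where
  carrier := {c | MemLp (fun x => ∑ i, c i * h i x) 2 (volume : Measure ℝ)}
  zero_mem' := by simp
  add_mem' := by
    intro c d hc hd
    have h1 := MemLp.add hc hd
    refine h1.ae_eq (Filter.Eventually.of_forall fun x => ?_)
    simp [add_mul, Finset.sum_add_distrib]
  smul_mem' := by
    intro r c hc
    have h1 := MemLp.const_smul hc r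
    refine h1.ae_eq (Filter.Eventually.of_forall fun x => ?_)
    simp [Finset.mul_sum, mul_assoc]

/-- The linear combination of the functions `h i` with given coefficients, as an element of
`L²(ℝ)`. -/
def coeffsToL2 {n : ℕ} (h : Fin n → ℝ → ℝ) : memLpCoeffs h →ₗ[ℝ] L2 where
  toFun c := MemLp.toLp _ c.2
  map_add' := by
    intro c d
    refine Eq.trans ?_ (MemLp.toLp_add (show MemLp _ _ _ from c.2) (show MemLp _ _ _ from d.2))
    refine MemLp.toLp_congr _ _ (Filter.Eventually.of_forall fun x => ?_)
    simp [add_mul, Finset.sum_add_distrib]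
  map_smul' := by
    intro r c
    refine Eq.trans ?_ (MemLp.toLp_const_smul r (show MemLp _ _ _ from c.2))
    refine MemLp.toLp_congr _ _ (Filter.Eventually.of_forall fun x => ?_)
    simp [Finset.mul_sum, mul_assoc]

/-- `P` is the preimage in `H¹(ℝ)` of a finite-dimensional, hence closed, subspace of `L²(ℝ)`. -/
theorem isClosed_P (N : ℕ) (β x₀ : ℝ) : IsClosed (P N β x₀ : Set H1) := by
  set h : Fin (N + 1) → ℝ → ℝ := fun i x => hermiteFun i (β * (x - x₀)) with hh
  have hP : (P N β x₀ : Set H1) = toL2L ⁻¹' (LinearMap.range (coeffsToL2 h) : Set L2) := by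
    ext v
    constructor
    · rintro ⟨c, hc⟩
      have hm : c ∈ memLpCoeffs h := (Lp.memLp (toL2 v)).ae_eq hc
      refine ⟨⟨c, hm⟩, Lp.ext ?_⟩
      exact (MemLp.coeFn_toLp hm).trans (Filter.EventuallyEq.symm hc)
    · rintro ⟨c, hc⟩
      refine ⟨c, ?_⟩
      have h1 := MemLp.coeFn_toLp c.2
      have h2 : MemLp.toLp _ c.2 = toL2 v := hc
      rw [h2] at h1
      exact h1
  rw [hP]
  exact (Submodule.closed_of_finiteDimensional _).preimage toL2L.continuous

/-! ### Functions in `X(0, t)` -/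

variable {t : ℝ} {u du z dz v : ℝ → H1}

theorem MemX.sub (hu : MemX t u du) (hz : MemX t z dz) (ht : 0 < t) :
    MemX t (u - z) (du - dz) where
  continuousOn := hu.continuousOn.sub hz.continuousOn
  memLp := hu.memLp.sub hz.memLp
  memLp_deriv := hu.memLp_deriv.sub hz.memLp_deriv
  weak_deriv := by
    intro φ hφ hc hs
    have hii : ∀ {w : ℝ → H1} {ψ : ℝ → ℝ}, Continuous ψ → MemLp w 2 (volume.restrict (Ioc 0 t)) →
        IntervalIntegrable (fun s => ψ s • w s) volume 0 t := by
      intro w ψ hψ hw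
      have hw' : IntervalIntegrable w volume 0 t :=
        (intervalIntegrable_iff_integrableOn_Ioc_of_le ht.le).2 (hw.integrable (by simp))
      exact hw'.continuousOn_smul hψ.continuousOn
    have hd : Continuous (deriv φ) := hφ.continuous_deriv (by simp)
    simp only [Pi.sub_apply, smul_sub]
    rw [intervalIntegral.integral_sub (hii hd hu.memLp) (hii hd hz.memLp),
      intervalIntegral.integral_sub (hii hφ.continuous hu.memLp_deriv)
        (hii hφ.continuous hz.memLp_deriv), hu.weak_deriv φ hφ hc hs, hz.weak_deriv φ hφ hc hs]
    abel

theorem memX_zero (t : ℝ) : MemX t 0 0 where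
  continuousOn := continuousOn_const
  memLp := MemLp.zero
  memLp_deriv := MemLp.zero
  weak_deriv := by simp

theorem memL2Time_zero (t : ℝ) (V : Submodule ℝ H1) : MemL2Time t V 0 :=
  ⟨MemLp.zero, Filter.Eventually.of_forall fun _ => V.zero_mem⟩

theorem MemL2Time.sub {V : Submodule ℝ H1} (hu : MemL2Time t V u) (hv : MemL2Time t V v) :
    MemL2Time t V (u - v) := by
  refine ⟨hu.1.sub hv.1, ?_⟩
  filter_upwards [hu.2, hv.2] with s h1 h2
  exact V.sub_mem h1 h2

/-- The initial value of a continuous curve with values in a closed subspace almost everywhere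
lies in that subspace. -/
theorem apply_zero_mem_of_ae_mem {V : Submodule ℝ H1} (hV : IsClosed (V : Set H1)) (ht : 0 < t)
    (hu : ContinuousOn u (Icc 0 t)) (hv : ∀ᵐ s ∂(volume.restrict (Ioc 0 t)), u s ∈ V) :
    u 0 ∈ V := by
  have hne : (V : Set H1).Nonempty := ⟨0, V.zero_mem⟩
  have h : EqOn (fun s => Metric.infDist (u s) V) (fun _ => 0) (Icc 0 t) := by
    refine Measure.eqOn_Icc_of_ae_eq volume ht.ne ?_
      ((Metric.continuous_infDist_pt _).comp_continuousOn hu) continuousOn_const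
    rw [← restrict_Ioc_eq_restrict_Icc]
    filter_upwards [hv] with s hs
    exact Metric.infDist_zero_of_mem hs
  exact (hV.mem_iff_infDist_zero hne).2 (h (left_mem_Icc.2 ht.le))

theorem MemX.two_mul_integral_inner (hu : MemX t u du) (ht : 0 < t) :
    2 * ∫ s in (0 : ℝ)..t, inner ℝ (toL2 (du s)) (toL2 (u s)) =
      ‖toL2 (u t)‖ ^ 2 - ‖toL2 (u 0)‖ ^ 2 := by
  have hdu : IntervalIntegrable du volume 0 t :=
    (intervalIntegrable_iff_integrableOn_Ioc_of_le ht.le).2 (hu.memLp_deriv.integrable (by simp))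
  have hLdu : IntervalIntegrable (fun s => toL2L (du s)) volume 0 t :=
    ⟨toL2L.integrable_comp hdu.1, toL2L.integrable_comp hdu.2⟩
  refine integral_inner_eq_of_primitive (w := fun s => toL2L (u s)) (dw := fun s => toL2L (du s))
    ht.le hLdu fun s hs => ?_
  have h := eq_add_integral_of_weak_deriv ht hu.continuousOn hdu hu.weak_deriv s hs
  have hds : IntervalIntegrable du volume 0 s := hdu.mono_set
    (uIcc_subset_uIcc left_mem_uIcc (by rwa [uIcc_of_le ht.le]))
  rw [toL2L.intervalIntegral_comp_comm hds, ← map_add, ← h]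

theorem integrable_norm_sq_add (hu : MemX t u du) :
    Integrable (fun s => ‖u s‖ ^ 2 + ‖du s‖ ^ 2) (volume.restrict (Ioc 0 t)) :=
  hu.memLp.norm.integrable_sq.add hu.memLp_deriv.norm.integrable_sq

theorem integrable_norm_mul_norm {w : ℝ → H1} (hu : MemLp u 2 (volume.restrict (Ioc 0 t)))
    (hw : MemLp w 2 (volume.restrict (Ioc 0 t))) :
    Integrable (fun s => ‖u s‖ * ‖w s‖) (volume.restrict (Ioc 0 t)) :=
  hu.norm.integrable_mul hw.norm

/-- The trace estimate: the norm of `X(0, t)` controls the final value in `L²(ℝ)`. -/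
theorem MemX.norm_toL2_apply_le (hu : MemX t u du) (ht : 0 < t) :
    ‖toL2 (u t)‖ ≤ normX t u du := by
  refine Real.le_sqrt_of_sq_le ?_
  have h := hu.two_mul_integral_inner ht
  have hle : ‖∫ s in (0 : ℝ)..t, 2 * inner ℝ (toL2 (du s)) (toL2 (u s))‖ ≤
      ∫ s in (0 : ℝ)..t, (‖u s‖ ^ 2 + ‖du s‖ ^ 2) := by
    refine intervalIntegral.norm_integral_le_of_norm_le ht.le
      (Filter.Eventually.of_forall fun s _ => ?_)
      ((intervalIntegrable_iff_integrableOn_Ioc_of_le ht.le).2 (integrable_norm_sq_add hu))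
    rw [Real.norm_eq_abs, abs_mul, abs_two]
    nlinarith [abs_inner_toL2_le (du s) (u s), sq_nonneg (‖du s‖ - ‖u s‖)]
  rw [intervalIntegral.integral_const_mul] at hle
  have := (le_abs_self _).trans hle
  linarith

/-! ### The space-time form -/

variable {T c₀ C₀ : ℝ} {a : ℝ → LinearMap.BilinForm ℝ H1}

theorem Ioc_subset_Icc_of_le {t T : ℝ} (htT : t ≤ T) : Ioc 0 t ⊆ Icc 0 T :=
  fun _ hs => ⟨hs.1.le, hs.2.trans htT⟩

namespace IsModelForm

theorem continuous_right (ha : IsModelForm T c₀ C₀ a) {s : ℝ} (hs : s ∈ Icc 0 T) (v : H1) :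
    Continuous fun w => a s v w :=
  (LinearMap.mkContinuous (a s v) (C₀ * ‖v‖) fun w => ha.bounded s hs v w).continuous

theorem continuous_left (ha : IsModelForm T c₀ C₀ a) {s : ℝ} (hs : s ∈ Icc 0 T) (w : H1) :
    Continuous fun v => a s v w := by
  have h : (fun v => a s v w) = fun v => a s w v := funext fun v => ha.symm s hs v w
  rw [h]
  exact ha.continuous_right hs w

theorem aestronglyMeasurable_apply (ha : IsModelForm T c₀ C₀ a) (htT : t ≤ T)
    (hu : AEStronglyMeasurable u (volume.restrict (Ioc 0 t)))
    (hv : AEStronglyMeasurable v (volume.restrict (Ioc 0 t))) :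
    AEStronglyMeasurable (fun s => a s (u s) (v s)) (volume.restrict (Ioc 0 t)) := by
  have hsub := Ioc_subset_Icc_of_le htT
  refine aestronglyMeasurable_apply_curve (g := fun s w => a s (u s) w) (fun w => ?_) ?_ hv
  · refine aestronglyMeasurable_apply_curve (g := fun s y => a s y w)
      (fun y => (ha.measurable y w).mono_measure (Measure.restrict_mono hsub le_rfl)) ?_ hu
    filter_upwards [ae_restrict_mem measurableSet_Ioc] with s hs
    exact ha.continuous_left (hsub hs) w
  · filter_upwards [ae_restrict_mem measurableSet_Ioc] with s hs
    exact ha.continuous_right (hsub hs) (u s)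

theorem integrable_apply (ha : IsModelForm T c₀ C₀ a) (htT : t ≤ T)
    (hu : MemLp u 2 (volume.restrict (Ioc 0 t))) (hv : MemLp v 2 (volume.restrict (Ioc 0 t))) :
    Integrable (fun s => a s (u s) (v s)) (volume.restrict (Ioc 0 t)) := by
  refine ((integrable_norm_mul_norm hu hv).const_mul C₀).mono'
    (ha.aestronglyMeasurable_apply htT hu.1 hv.1) ?_
  filter_upwards [ae_restrict_mem measurableSet_Ioc] with s hs
  rw [← mul_assoc]
  exact ha.bounded s (Ioc_subset_Icc_of_le htT hs) _ _

end IsModelForm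

theorem integrable_inner_toL2 (hu : MemLp u 2 (volume.restrict (Ioc 0 t)))
    (hv : MemLp v 2 (volume.restrict (Ioc 0 t))) :
    Integrable (fun s => inner ℝ (toL2 (u s)) (toL2 (v s))) (volume.restrict (Ioc 0 t)) := by
  refine (integrable_norm_mul_norm hu hv).mono' ?_
    (Filter.Eventually.of_forall fun s => abs_inner_toL2_le (u s) (v s))
  exact (toL2L.continuous.comp_aestronglyMeasurable hu.1).inner
    (toL2L.continuous.comp_aestronglyMeasurable hv.1)

/-- The Cauchy–Schwarz bound on the space-time form; its constant depends on `C₀` only. -/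
theorem IsModelForm.isContinuityConst (ha : IsModelForm T c₀ C₀ a) (ht : t ∈ Ioc 0 T)
    (V : Submodule ℝ H1) : IsContinuityConst a t V (1 + C₀) := by
  have hC : 0 < C₀ := ha.pos.trans ha.lt
  refine ⟨by linarith, fun u du v w hu hv _ => ?_⟩
  set A : ℝ := ∫ s in (0 : ℝ)..t, (‖u s‖ ^ 2 + ‖du s‖ ^ 2) with hA
  set B : ℝ := ∫ s in (0 : ℝ)..t, ‖v s‖ ^ 2 with hB
  have hA0 : 0 ≤ A := intervalIntegral.integral_nonneg ht.1.le fun s _ => by positivity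
  have hB0 : 0 ≤ B := intervalIntegral.integral_nonneg ht.1.le fun s _ => by positivity
  have hF : MemLp (fun s => √(‖u s‖ ^ 2 + ‖du s‖ ^ 2)) 2 (volume.restrict (Ioc 0 t)) := by
    refine (memLp_two_iff_integrable_sq
      (Real.continuous_sqrt.comp_aestronglyMeasurable (integrable_norm_sq_add hu).1)).2 ?_
    refine (integrable_norm_sq_add hu).congr (Filter.Eventually.of_forall fun s => ?_)
    exact (Real.sq_sqrt (by positivity)).symm
  have hprod := integral_mul_le_sqrt_mul_sqrt (fun s => Real.sqrt_nonneg _)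
    (fun s => norm_nonneg (v s)) hF hv.1.norm
  have hsq : ∀ s, √(‖u s‖ ^ 2 + ‖du s‖ ^ 2) ^ 2 = ‖u s‖ ^ 2 + ‖du s‖ ^ 2 :=
    fun s => Real.sq_sqrt (by positivity)
  simp only [hsq] at hprod
  rw [← intervalIntegral.integral_of_le ht.1.le, ← intervalIntegral.integral_of_le ht.1.le,
    ← intervalIntegral.integral_of_le ht.1.le, ← hA, ← hB] at hprod
  have hbound : ‖∫ s in (0 : ℝ)..t, (inner ℝ (toL2 (du s)) (toL2 (v s)) + a s (u s) (v s))‖ ≤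
      ∫ s in (0 : ℝ)..t, (1 + C₀) * (√(‖u s‖ ^ 2 + ‖du s‖ ^ 2) * ‖v s‖) := by
    refine intervalIntegral.norm_integral_le_of_norm_le ht.1.le
      (Filter.Eventually.of_forall fun s hs => ?_)
      ((intervalIntegrable_iff_integrableOn_Ioc_of_le ht.1.le).2
        ((hF.integrable_mul hv.1.norm).const_mul _))
    have h1 := abs_inner_toL2_le (du s) (v s)
    have h2 := ha.bounded s (Ioc_subset_Icc_of_le ht.2 hs) (u s) (v s)
    have h3 : ‖du s‖ ≤ √(‖u s‖ ^ 2 + ‖du s‖ ^ 2) :=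
      Real.le_sqrt_of_sq_le (le_add_of_nonneg_left (sq_nonneg _))
    have h4 : ‖u s‖ ≤ √(‖u s‖ ^ 2 + ‖du s‖ ^ 2) :=
      Real.le_sqrt_of_sq_le (le_add_of_nonneg_right (sq_nonneg _))
    have h5 := mul_le_mul_of_nonneg_right h3 (norm_nonneg (v s))
    have h6 := mul_le_mul_of_nonneg_left (mul_le_mul_of_nonneg_right h4 (norm_nonneg (v s))) hC.le
    refine (abs_add_le _ _).trans ?_
    linarith
  rw [intervalIntegral.integral_const_mul] at hbound
  have hinit := real_inner_le_norm (toL2 (u 0)) (toL2 w)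
  have h7 := (le_abs_self _).trans hbound
  have h8 := mul_le_mul_of_nonneg_left hprod (by linarith : 0 ≤ 1 + C₀)
  have hCS : √A * √B + ‖toL2 (u 0)‖ * ‖toL2 w‖ ≤
      √(A + ‖toL2 (u 0)‖ ^ 2) * √(B + ‖toL2 w‖ ^ 2) := by
    rw [← Real.sqrt_mul (x := A + ‖toL2 (u 0)‖ ^ 2) (by positivity)]
    refine Real.le_sqrt_of_sq_le ?_
    nlinarith [sq_nonneg (√A * ‖toL2 w‖ - √B * ‖toL2 (u 0)‖), Real.sq_sqrt hA0, Real.sq_sqrt hB0]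
  have h9 := mul_le_mul_of_nonneg_left hCS (by linarith : 0 ≤ 1 + C₀)
  have h10 : 0 ≤ C₀ * (‖toL2 (u 0)‖ * ‖toL2 w‖) := by positivity
  rw [spaceTimeForm, normX, normY, ← hA, ← hB, mul_assoc]
  linarith

theorem spaceTimeForm_sub (ha : IsModelForm T c₀ C₀ a) (ht : t ∈ Ioc 0 T) (hu : MemX t u du)
    (hz : MemX t z dz) (hv : MemLp v 2 (volume.restrict (Ioc 0 t))) (w : H1) :
    spaceTimeForm a t (u - z) (du - dz) v w =
      spaceTimeForm a t u du v w - spaceTimeForm a t z dz v w := by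
  have hi : ∀ {y dy : ℝ → H1}, MemX t y dy → IntervalIntegrable
      (fun s => inner ℝ (toL2 (dy s)) (toL2 (v s)) + a s (y s) (v s)) volume 0 t := fun hy =>
    (intervalIntegrable_iff_integrableOn_Ioc_of_le ht.1.le).2
      ((integrable_inner_toL2 hy.memLp_deriv hv).add (ha.integrable_apply ht.2 hy.memLp hv))
  have h : ∀ s, inner ℝ (toL2 ((du - dz) s)) (toL2 (v s)) + a s ((u - z) s) (v s) =
      (inner ℝ (toL2 (du s)) (toL2 (v s)) + a s (u s) (v s)) -
        (inner ℝ (toL2 (dz s)) (toL2 (v s)) + a s (z s) (v s)) := by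
    intro s
    simp only [Pi.sub_apply, map_sub, inner_sub_left, LinearMap.sub_apply]
    ring
  simp only [spaceTimeForm, h]
  rw [intervalIntegral.integral_sub (hi hu) (hi hz), Pi.sub_apply, map_sub, inner_sub_left]
  ring

/-- Tested with itself and its initial value, the space-time form controls both end values and the
`L²(0, t; H¹)` norm. -/
theorem le_spaceTimeForm_self (ha : IsModelForm T c₀ C₀ a) (ht : t ∈ Ioc 0 T)
    (hu : MemX t u du) :
    1 / 2 * ‖toL2 (u t)‖ ^ 2 + min (1 / 2) c₀ * normY t u (u 0) ^ 2 ≤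
      spaceTimeForm a t u du u (u 0) := by
  have hi1 := integrable_inner_toL2 hu.memLp_deriv hu.memLp
  have hi2 := ha.integrable_apply ht.2 hu.memLp hu.memLp
  have hen := hu.two_mul_integral_inner ht.1
  set D : ℝ := ∫ s in (0 : ℝ)..t, ‖u s‖ ^ 2 with hD
  have hD0 : 0 ≤ D := intervalIntegral.integral_nonneg ht.1.le fun s _ => by positivity
  have hco : c₀ * D ≤ ∫ s in (0 : ℝ)..t, a s (u s) (u s) := by
    rw [hD, ← intervalIntegral.integral_const_mul, intervalIntegral.integral_of_le ht.1.le,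
      intervalIntegral.integral_of_le ht.1.le]
    refine integral_mono_ae (hu.memLp.norm.integrable_sq.const_mul c₀) hi2 ?_
    filter_upwards [ae_restrict_mem measurableSet_Ioc] with s hs
    exact ha.coercive s (Ioc_subset_Icc_of_le ht.2 hs) (u s)
  rw [spaceTimeForm, intervalIntegral.integral_add
    ((intervalIntegrable_iff_integrableOn_Ioc_of_le ht.1.le).2 hi1)
    ((intervalIntegrable_iff_integrableOn_Ioc_of_le ht.1.le).2 hi2),
    real_inner_self_eq_norm_sq, normY, ← hD, Real.sq_sqrt (by positivity)]
  have h1 := mul_le_mul_of_nonneg_right (min_le_left (1 / 2) c₀) (sq_nonneg ‖toL2 (u 0)‖)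
  have h2 := mul_le_mul_of_nonneg_right (min_le_right (1 / 2) c₀) hD0
  linarith

/-- The weak formulation may be tested with time-dependent functions: the exceptional null sets
are uniform in the test function because `H¹(ℝ)` is separable. -/
theorem IsWeakSolution.spaceTimeForm_eq (ha : IsModelForm T c₀ C₀ a) (ht : t ∈ Ioc 0 T)
    {f : ℝ → L2} {u₀ : L2} (hu : IsWeakSolution a f u₀ t u du) (v : ℝ → H1) (w : H1) :
    spaceTimeForm a t u du v w =
      (∫ s in (0 : ℝ)..t, inner ℝ (f s) (toL2 (v s))) + inner ℝ u₀ (toL2 w) := by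
  have := separableSpace_H1
  obtain ⟨D, hDc, hDd⟩ := TopologicalSpace.exists_countable_dense H1
  have hall : ∀ᵐ s ∂(volume.restrict (Ioc 0 t)), ∀ y ∈ D,
      inner ℝ (toL2 (du s)) (toL2 y) + a s (u s) y = inner ℝ (f s) (toL2 y) :=
    (ae_ball_iff hDc).2 fun y _ => hu.equation y
  rw [spaceTimeForm, hu.initial w, intervalIntegral.integral_of_le ht.1.le,
    intervalIntegral.integral_of_le ht.1.le]
  congr 1
  refine integral_congr_ae ?_
  filter_upwards [hall, ae_restrict_mem measurableSet_Ioc] with s hs hst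
  have hc1 : Continuous fun y : H1 => inner ℝ (toL2 (du s)) (toL2 y) :=
    continuous_const.inner toL2L.continuous
  have hc2 : Continuous fun y : H1 => inner ℝ (f s) (toL2 y) :=
    continuous_const.inner toL2L.continuous
  exact congrFun (Continuous.ext_on hDd
    (hc1.add (ha.continuous_right (Ioc_subset_Icc_of_le ht.2 hst) (u s))) hc2 hs) (v s)

/-! ### The error estimate -/

theorem bConst_pos (hc : 0 < c₀) (hC : c₀ < C₀) (N : ℕ) (β : ℝ) : 0 < bConst c₀ C₀ N β := by
  have : 0 < C₀ := hc.trans hC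
  unfold bConst
  refine lt_min (by norm_num) (lt_min (by positivity) (by positivity))

theorem bConst_sq_le (hc : 0 < c₀) (hC : c₀ < C₀) (N : ℕ) (β : ℝ) :
    bConst c₀ C₀ N β ^ 2 ≤ 2 * min (1 / 2) c₀ := by
  have hb := bConst_pos hc hC N β
  have h1 : bConst c₀ C₀ N β ≤ 1 / 4 := min_le_left _ _
  have h2 : bConst c₀ C₀ N β ≤ c₀ / 4 := (min_le_right _ _).trans (min_le_left _ _)
  rcases min_cases (1 / 2) c₀ with h | h <;> rw [h.1] <;> nlinarith

/-- The distance between the Galerkin solution and an arbitrary competitor `z` at the final time: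
Galerkin orthogonality replaces `U - z` by `u - z` as first argument of the space-time form. -/
theorem norm_toL2_sub_le_of_galerkin (ha : IsModelForm T c₀ C₀ a) (ht : t ∈ Ioc 0 T) {N : ℕ}
    {β x₀ B₀ : ℝ} (hB : IsContinuityConst a t (P N β x₀) B₀) {f : ℝ → L2} {u₀ : L2}
    {U dU : ℝ → H1} (hu : IsWeakSolution a f u₀ t u du)
    (hU : IsGalerkinSolution a f u₀ t (P N β x₀) U dU) (hzV : MemL2Time t (P N β x₀) z)
    (hz : MemX t z dz) :
    bConst c₀ C₀ N β * ‖toL2 (U t) - toL2 (z t)‖ ≤ B₀ * normX t (u - z) (du - dz) := by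
  have hb := bConst_pos ha.pos ha.lt N β
  have hb2 := bConst_sq_le ha.pos ha.lt N β
  set b := bConst c₀ C₀ N β
  have he : MemX t (U - z) (dU - dz) := hU.memX.sub hz ht.1
  have heV : MemL2Time t (P N β x₀) (U - z) := hU.memL2.sub hzV
  have he0 : (U - z) 0 ∈ P N β x₀ :=
    apply_zero_mem_of_ae_mem (isClosed_P N β x₀) ht.1 he.continuousOn heV.2
  have horth : spaceTimeForm a t (U - z) (dU - dz) (U - z) ((U - z) 0) =
      spaceTimeForm a t (u - z) (du - dz) (U - z) ((U - z) 0) := by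
    rw [spaceTimeForm_sub ha ht hU.memX hz heV.1, spaceTimeForm_sub ha ht hu.memX hz heV.1,
      hu.spaceTimeForm_eq ha ht, hU.equation _ _ heV he0]
  have hlow := le_spaceTimeForm_self ha ht he
  have hup := hB.2 (u - z) (du - dz) (U - z) ((U - z) 0) (hu.memX.sub hz ht.1) heV he0
  rw [horth] at hlow
  have hY : 0 ≤ normY t (U - z) ((U - z) 0) := Real.sqrt_nonneg _
  have hX : 0 ≤ normX t (u - z) (du - dz) := Real.sqrt_nonneg _
  have hn : toL2 ((U - z) t) = toL2 (U t) - toL2 (z t) := by rw [Pi.sub_apply, map_sub]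
  rw [hn] at hlow
  set Y := normY t (U - z) ((U - z) 0)
  set R := B₀ * normX t (u - z) (du - dz)
  set n := ‖toL2 (U t) - toL2 (z t)‖
  have hn0 : 0 ≤ n := norm_nonneg _
  have hR : 0 ≤ R := mul_nonneg hB.1 hX
  have hmain : 1 / 2 * n ^ 2 + 1 / 2 * (b * Y) ^ 2 ≤ R * Y := by
    nlinarith [mul_le_mul_of_nonneg_right hb2 (sq_nonneg Y)]
  rcases hY.eq_or_lt with h0 | hpos
  · rw [← h0] at hmain
    have : n = 0 := by nlinarith
    rw [this, mul_zero]
    exact hR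
  · -- Young's inequality `n (b Y) ≤ (n² + (b Y)²) / 2` lets the factor `Y` cancel.
    refine le_of_mul_le_mul_right ?_ hpos
    nlinarith [sq_nonneg (n - b * Y)]

end

end HermiteGalerkin

theorem theorem2 (T : ℝ) (hT : 0 < T) (c₀ C₀ : ℝ)
    (a : ℝ → LinearMap.BilinForm ℝ HermiteGalerkin.H1)
    (ha : HermiteGalerkin.IsModelForm T c₀ C₀ a) :
    (∃ B₀ : ℝ, ∀ t ∈ Set.Ioc 0 T, ∀ (N : ℕ) (β x₀ : ℝ), 0 < β →
      HermiteGalerkin.IsContinuityConst a t (HermiteGalerkin.P N β x₀) B₀) ∧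
    (∀ t ∈ Set.Ioc 0 T, ∀ (N : ℕ) (β x₀ B₀ : ℝ), 0 < β →
      HermiteGalerkin.IsContinuityConst a t (HermiteGalerkin.P N β x₀) B₀ →
      ∀ (f : ℝ → HermiteGalerkin.L2) (u₀ : HermiteGalerkin.L2)
        (u du U dU : ℝ → HermiteGalerkin.H1),
        HermiteGalerkin.IsWeakSolution a f u₀ t u du →
        HermiteGalerkin.IsGalerkinSolution a f u₀ t (HermiteGalerkin.P N β x₀) U dU →
        ‖HermiteGalerkin.toL2 (u t) - HermiteGalerkin.toL2 (U t)‖ ≤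
          (HermiteGalerkin.bConst c₀ C₀ N β + B₀) / HermiteGalerkin.bConst c₀ C₀ N β *
            HermiteGalerkin.bestApprox t (HermiteGalerkin.P N β x₀) u du) := by
  refine ⟨⟨1 + C₀, fun t ht N β x₀ _ => ha.isContinuityConst ht _⟩, ?_⟩
  intro t ht N β x₀ B₀ _ hB f u₀ u du U dU hu hU
  have hb := HermiteGalerkin.bConst_pos ha.pos ha.lt N β
  have hK : 0 ≤ (HermiteGalerkin.bConst c₀ C₀ N β + B₀) / HermiteGalerkin.bConst c₀ C₀ N β :=
    div_nonneg (add_nonneg hb.le hB.1) hb.le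
  -- The zero function is a competitor, so the infimum is over a nonempty set.
  have hne : Nonempty {z : (ℝ → HermiteGalerkin.H1) × (ℝ → HermiteGalerkin.H1) //
      HermiteGalerkin.MemL2Time t (HermiteGalerkin.P N β x₀) z.1 ∧
        HermiteGalerkin.MemX t z.1 z.2} :=
    ⟨⟨(0, 0), HermiteGalerkin.memL2Time_zero t _, HermiteGalerkin.memX_zero t⟩⟩
  rw [HermiteGalerkin.bestApprox, Real.mul_iInf_of_nonneg hK]
  refine le_ciInf fun ⟨⟨z, dz⟩, hzV, hz⟩ => ?_
  have h1 := HermiteGalerkin.norm_toL2_sub_le_of_galerkin ha ht hB hu hU hzV hz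
  have h2 := (hu.memX.sub hz ht.1).norm_toL2_apply_le ht.1
  rw [Pi.sub_apply, map_sub] at h2
  have h3 := norm_sub_le_norm_sub_add_norm_sub (HermiteGalerkin.toL2 (u t))
    (HermiteGalerkin.toL2 (z t)) (HermiteGalerkin.toL2 (U t))
  rw [norm_sub_rev (HermiteGalerkin.toL2 (z t))] at h3
  rw [div_mul_eq_mul_div, le_div_iff₀ hb, add_mul, mul_comm]
  refine (mul_le_mul_of_nonneg_left h3 hb.le).trans ?_
  rw [mul_add]
  exact add_le_add (mul_le_mul_of_nonneg_left h2 hb.le) h1
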